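/- An updateable timed automaton is a tuple $\mathcal A=(Q,X,q_0,T,F)$ with a finite set $Q$ of states, a finite set $X$ of clocks, an initial state $q_0\in Q$, accepting states $F\subseteq Q$ and a finite set $T$ of transitions $(q,g,up,q')$. Here $g$ is a finite conjunction of atomic constraints, each either non-diagonal ($x\triangleleft c$ or $c\triangleleft x$) or diagonal ($x-y\triangleleft d$), and $up$ assigns to each clock $x$ an atomic update $x:=c$ or $x:=y+d$, where $x,y\in X$, $c\in\mathbb N$, $d\in\mathbb Z$ and ${\triangleleft}\in\{<,\le\}$; $x:=y$ stands for $x:=y+0$. A valuation is a map $v:X\to\mathbb R_{\ge 0}$, and $up(v)(x)$ is $c$, respectively $v(y)+d$. A run starts in $(q_0,\mathbf 0)$ and consists of finitely many (possibly no) steps; a step goes from $(q,v)$ to $(q',up(v+\delta))$ for some $\delta\ge 0$ and some $(q,g,up,q')\in T$ with $v+\delta\models g$ and $up(v+\delta)(x)\ge 0$ for all $x\in X$. The reachability problem asks whether $\mathcal A$ has a run that ends in a state of $F$. For an atomic constraint $\varphi$ and an update $up$, let $\varphi[up]$ be the result of replacing each clock $x$ in $\varphi$ by $c$ if $up$ has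 $x:=c$, and by $y+d$ if $up$ has $x:=y+d$, and collecting the constants. Let $\mathrm{wp}(\varphi,up)=\{\varphi[up]\}$ if $\varphi[up]$ is a diagonal constraint on two different clocks or has the form $z\triangleleft e$ or $e\triangleleft z$ with $z\in X$ and $e\ge 0$, and let $\mathrm{wp}(\varphi,up)=\emptyset$ otherwise; for a set $\mathcal G$ of atomic constraints let $\mathrm{wp}(\mathcal G,up)=\bigcup_{\varphi\in\mathcal G}\mathrm{wp}(\varphi,up)$. Identifying a guard with the set of its conjuncts, define for $q\in Q$ and $i\ge 0$ $$\mathcal G^0(q)=\bigcup_{(q,g,up,q')\in T}\bigl(g\cup \mathrm{wp}(\{0\le x\mid x\in X\},up)\bigr),\qquad \mathcal G^{i+1}(q)=\bigcup_{(q,g,up,q')\in T}\bigl(\mathcal G^i(q)\cup \mathrm{wp}(\mathcal G^i(q'),up)\bigr).$$ Let $M$ be the maximum of the $|d|$ over all constants $d$ that occur in a guard or an update of $\mathcal A$ ($M=0$ if there are none). Consider the following two classes of updateable timed automata: (a) all guards consist of non-diagonal constraints, and all updates are of the form $x:=c$, $x:=y$ or $x:=y+c$ with $c\ge 0$; (b)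 guards may contain diagonal constraints, and all updates are of the form $x:=c$ or $x:=y$. Then reachability is decidable for the automata in class (a), and it is decidable for the automata in class (b). Moreover, for every automaton in class (a) or (b) there is a $k$ with $\mathcal G^{k+1}(q)=\mathcal G^k(q)$ for all $q\in Q$, and for all $i\ge0$ and $q\in Q$, the constant of every diagonal constraint in $\mathcal G^i(q)$ occurs in a guard of $\mathcal A$, and the constant of every non-diagonal constraint in $\mathcal G^i(q)$ is at most $2M$. -/

import Mathlib

namespace UTA

/-! ### Clock constraints and guards -/

/-- The comparison symbol `◁`, one of `<` and `≤`. -/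
inductive Cmp where
  | lt
  | le

/-- `s.Holds a b` is `a ◁ b`. -/
def Cmp.Holds : Cmp → ℝ → ℝ → Prop
  | .lt, a, b => a < b
  | .le, a, b => a ≤ b

/-- Atomic clock constraints over a set `X` of clocks. -/
inductive Constraint (X : Type) where
  /-- `x ◁ c` -/
  | upper (x : X) (s : Cmp) (c : ℕ)
  /-- `c ◁ x` -/
  | lower (c : ℕ) (s : Cmp) (x : X)
  /-- `x - y ◁ d` -/
  | diag (x y : X) (s : Cmp) (d : ℤ)

/-- A clock valuation maps every clock to a non-negative real. -/
abbrev Valuation (X : Type) := X → NNReal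

/-- `v ⊨ φ` for an atomic constraint `φ`. -/
def Constraint.Sat {X : Type} (v : Valuation X) : Constraint X → Prop
  | .upper x s c => s.Holds (v x : ℝ) (c : ℝ)
  | .lower c s x => s.Holds (c : ℝ) (v x : ℝ)
  | .diag x y s d => s.Holds ((v x : ℝ) - (v y : ℝ)) (d : ℝ)

/-- Diagonal constraints are those of the form `x - y ◁ d`. -/
def Constraint.IsDiagonal {X : Type} : Constraint X → Prop
  | .diag _ _ _ _ => True
  | _ => False

/-- The constant that occurs in an atomic constraint. -/
def Constraint.const {X : Type} : Constraint X → ℤ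
  | .upper _ _ c => c
  | .lower c _ _ => c
  | .diag _ _ _ d => d

/-- A guard is a conjunction of atomic constraints, given by the list of its conjuncts. -/
abbrev Guard (X : Type) := List (Constraint X)

/-- `v ⊨ g` for a guard `g`. -/
def Guard.Sat {X : Type} (v : Valuation X) (g : Guard X) : Prop :=
  ∀ φ ∈ g, Constraint.Sat v φ

/-! ### Updates -/

/-- The right-hand side of an atomic update `x := c` (with `c : ℕ`) or `x := y + d`
(with `d : ℤ`). The update `x := y` is `x := y + 0`. -/
inductive AtomicUpdate (X : Type) where
  | const (c : ℕ)
  | shift (y : X) (d : ℤ)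

/-- The constant that occurs in an atomic update. -/
def AtomicUpdate.offset {X : Type} : AtomicUpdate X → ℤ
  | .const c => c
  | .shift _ d => d

/-- The value of the right-hand side of an atomic update; it may be negative. -/
def AtomicUpdate.eval {X : Type} (v : Valuation X) : AtomicUpdate X → ℝ
  | .const c => (c : ℝ)
  | .shift y d => (v y : ℝ) + (d : ℝ)

/-- An update has one atomic update for each clock. -/
abbrev Update (X : Type) := X → AtomicUpdate X

/-! ### Updateable timed automata and their runs -/

/-- A transition `(q, g, up, q')`. -/
structure Transition (Q X : Type) where
  src : Q
  guard : Guard X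
  update : Update X
  tgt : Q

/-- An updateable timed automaton `(Q, X, q₀, T, F)`. As it serves as the input of an algorithm,
its states are numbered, `Q = {0, …, numStates - 1}`, so are its clocks,
`X = {0, …, numClocks - 1}`, and the finite sets `T` and `F` are given by lists. -/
structure Automaton where
  numStates : ℕ
  numClocks : ℕ
  init : Fin numStates
  trans : List (Transition (Fin numStates) (Fin numClocks))
  final : List (Fin numStates)

namespace Automaton

abbrev State (A : Automaton) := Fin A.numStates

abbrev Clock (A : Automaton) := Fin A.numClocks

/-- Configurations `(q, v)`. -/
abbrev Config (A : Automaton) := A.State × Valuation A.Clock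

/-- Delay transitions `(q, v) → (q, v + δ)` with `δ ≥ 0`. -/
def Delay (A : Automaton) (κ κ' : A.Config) : Prop :=
  ∃ δ : NNReal, κ' = (κ.1, fun x => κ.2 x + δ)

/-- Action transitions `(q, v) → (q', v')` for `(q, g, up, q') ∈ T`, where `v ⊨ g`, and `v' = up(v)`
is a valuation, that is, it is non-negative. -/
def Action (A : Automaton) (κ κ' : A.Config) : Prop :=
  ∃ t ∈ A.trans, t.src = κ.1 ∧ t.tgt = κ'.1 ∧ Guard.Sat κ.2 t.guard ∧
    (∀ x, 0 ≤ (t.update x).eval κ.2) ∧ ∀ x, (κ'.2 x : ℝ) = (t.update x).eval κ.2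

/-- One step of a run: a delay transition followed by an action transition. -/
def Step (A : Automaton) : A.Config → A.Config → Prop :=
  Relation.Comp A.Delay A.Action

/-- Some run from the initial state, with all clocks at `0`, ends in an accepting state. -/
def HasAcceptingRun (A : Automaton) : Prop :=
  ∃ κ : A.Config, Relation.ReflTransGen A.Step (A.init, fun _ => 0) κ ∧ κ.1 ∈ A.final

/-! ### The two classes of automata -/

/-- All guards are non-diagonal, and all updates are of the form `x := c`, `x := y`, or
`x := y + d` with `d ≥ 0`. -/
def DiagonalFreeIncrementing (A : Automaton) : Prop :=
  ∀ t ∈ A.trans, (∀ φ ∈ t.guard, ¬ φ.IsDiagonal) ∧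
    ∀ x, (∃ c, t.update x = .const c) ∨ ∃ y d, 0 ≤ d ∧ t.update x = .shift y d

/-- Guards are arbitrary (diagonal constraints are allowed), and all updates are of the form
`x := c` or `x := y`. -/
def DiagonalCopying (A : Automaton) : Prop :=
  ∀ t ∈ A.trans, ∀ x, (∃ c, t.update x = .const c) ∨ ∃ y, t.update x = .shift y 0

end Automaton

/-! ### Decidability

An automaton is handed to an algorithm as a finite object built from natural numbers by pairs and lists. -/

def Cmp.isStrict : Cmp → Bool
  | .lt => true
  | .le => false

/-- An integer `d` as the pair of its positive part and its negative part. -/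
def codeInt (d : ℤ) : ℕ × ℕ := (d.toNat, (-d).toNat)

/-- The kind of constraint (`0`, `1`, `2` for `x ◁ c`, `c ◁ x`, `x - y ◁ d`), its clocks (listed
twice if there is only one), whether `◁` is strict, and the constant. -/
abbrev ConstraintCode := ℕ × (ℕ × ℕ) × Bool × (ℕ × ℕ)

def Constraint.code {n : ℕ} : Constraint (Fin n) → ConstraintCode
  | .upper x s c => (0, (x, x), s.isStrict, codeInt c)
  | .lower c s x => (1, (x, x), s.isStrict, codeInt c)
  | .diag x y s d => (2, (x, y), s.isStrict, codeInt d)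

/-- The clock on the right-hand side, if there is one, and the constant. -/
abbrev AtomicUpdateCode := Option ℕ × (ℕ × ℕ)

def AtomicUpdate.code {n : ℕ} : AtomicUpdate (Fin n) → AtomicUpdateCode
  | .const c => (none, codeInt c)
  | .shift y d => (some y, codeInt d)

/-- Source, conjuncts of the guard, atomic updates of the clocks in their order, target. -/
abbrev TransitionCode := ℕ × List ConstraintCode × List AtomicUpdateCode × ℕ

def Transition.code {m n : ℕ} (t : Transition (Fin m) (Fin n)) : TransitionCode :=
  (t.src, t.guard.map Constraint.code, List.ofFn fun x => (t.update x).code, t.tgt)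

/-- Number of states, number of clocks, initial state, transitions, accepting states. -/
abbrev AutomatonCode := ℕ × ℕ × ℕ × List TransitionCode × List ℕ

def Automaton.code (A : Automaton) : AutomatonCode :=
  (A.numStates, A.numClocks, A.init, A.trans.map Transition.code, A.final.map Fin.val)

/-- The property `P` is decidable on the class `C` of automata: one algorithm (a total computable
function) decides, from the description of any automaton in `C`, whether it has property `P`. -/
def DecidableOn (C P : Automaton → Prop) : Prop :=
  ∃ f : AutomatonCode → Bool, Computable f ∧ ∀ A : Automaton, C A → (f A.code = true ↔ P A)

/-! ### State-based guards -/

/-- The weakest precondition of an atomic constraint over an update `up`: the constraint that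
results when every clock `x` is replaced by `up(x)`, if this is a diagonal constraint on two
different clocks, or has the form `z ◁ d` or `d ◁ z` with a clock `z` and `d ≥ 0`; otherwise
there is none. -/
def Constraint.wp {X : Type} [DecidableEq X] (up : Update X) :
    Constraint X → Option (Constraint X)
  | .upper x s c =>
    match up x with
    | .const _ => none
    | .shift z d => if 0 ≤ (c : ℤ) - d then some (.upper z s ((c : ℤ) - d).toNat) else none
  | .lower c s x =>
    match up x with
    | .const _ => none
    | .shift z d => if 0 ≤ (c : ℤ) - d then some (.lower ((c : ℤ) - d).toNat s z) else none
  | .diag x y s c =>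
    match up x, up y with
    | .const _, .const _ => none
    | .shift z d, .const e =>
      if 0 ≤ c - d + e then some (.upper z s (c - d + e).toNat) else none
    | .const e, .shift z d =>
      if 0 ≤ (e : ℤ) - d - c then some (.lower ((e : ℤ) - d - c).toNat s z) else none
    | .shift z d, .shift w e =>
      if z = w then none else some (.diag z w s (c - d + e))

/-- The weakest precondition of a set of atomic constraints. -/
def wpSet {X : Type} [DecidableEq X] (G : Set (Constraint X)) (up : Update X) :
    Set (Constraint X) :=
  {ψ | ∃ φ ∈ G, Constraint.wp up φ = some ψ}

namespace Automaton

/-- The fixed-point iteration for the state-based guards. Stage `0` at `q` has, for every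
transition `(q, g, up, q')`, the conjuncts of `g` and the weakest precondition over `up` of
`{0 ≤ x | x ∈ X}`; stage `i + 1` at `q` adds to stage `i` at `q` the weakest precondition over `up`
of stage `i` at `q'`. -/
def stateGuards (A : Automaton) : ℕ → A.State → Set (Constraint A.Clock)
  | 0, q => {φ | ∃ t ∈ A.trans, t.src = q ∧
      (φ ∈ t.guard ∨ φ ∈ wpSet (Set.range fun x => Constraint.lower 0 .le x) t.update)}
  | i + 1, q => {φ | ∃ t ∈ A.trans, t.src = q ∧
      (φ ∈ A.stateGuards i q ∨ φ ∈ wpSet (A.stateGuards i t.tgt) t.update)}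

/-- The absolute values of the constants that occur in the guards and in the updates. -/
def constants (A : Automaton) : List ℕ :=
  A.trans.flatMap fun t =>
    t.guard.map (fun φ => φ.const.natAbs) ++
      List.ofFn fun x : A.Clock => (t.update x).offset.natAbs

/-- The number `M`, the largest of these absolute values (`0` if there are none). -/
def maxConstant (A : Automaton) : ℕ := A.constants.foldr max 0

end Automaton

end UTA

/-! Decidability rests on `RegionEquiv N D`, which respects the guards and is stable under delays
(`RegionEquiv.exists_delay`) and updates (`RegionEquiv.update`). Pulling a non-diagonal constraint
back over a non-negative offset only lowers its constant, so the constants up to `N` suffice.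
Diagonal constants could drift under non-zero offsets. Class (a) therefore takes `D = 0`, where no
diagonal constraint on large clocks is tracked; in class (b) all offsets vanish and `D` exceeds
every constant of a guard.

There are finitely many regions, so a run that meets a state and region twice can be shortened; this
bounds the length of the runs to be considered by a computable `B`
(`Automaton.Tame.exists_short_run`). The algorithm then searches concrete runs instead of regions. A
delay can always be replaced by a landmark (`0` or some `c - w x`), the midpoint of two landmarks,
or a landmark plus `1`. Hence one step at most halves the mesh, and runs of at most `B` steps can be
moved to the grid of mesh `2 ^ (-B)` with delays at most `N + 1`
(`Automaton.Tame.exists_mem_gridReach`). This finite search is primitive recursive.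

The claims on state-based guards are proved separately. `Automaton.Bounded` is an invariant of the
iteration, so all stages live in one finite set of constraints, and an increasing sequence of its
subsets stabilises. -/

namespace UTA

/-! ### Exploring the runs on a grid

For a scale `s`, the natural number `k` stands for the real number `k / s`. -/

/-- The left-hand side of an encoded constraint, in units of `1 / s`. -/
def gridLhs (s : ℕ) (v : List ℕ) (φ : ConstraintCode) : ℕ :=
  if φ.1 = 0 then v.getD φ.2.1.1 0
  else if φ.1 = 1 then φ.2.2.2.1 * s
  -- The negative part of `d` moves to the left and the positive part to the right, which avoids
  -- subtraction.
  else v.getD φ.2.1.1 0 + φ.2.2.2.2 * s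

/-- The right-hand side of an encoded constraint, in units of `1 / s`. -/
def gridRhs (s : ℕ) (v : List ℕ) (φ : ConstraintCode) : ℕ :=
  if φ.1 = 0 then φ.2.2.2.1 * s
  else if φ.1 = 1 then v.getD φ.2.1.1 0
  else v.getD φ.2.1.2 0 + φ.2.2.2.1 * s

/-- Satisfaction of an encoded constraint by the clock values `v`, in units of `1 / s`. -/
def GridSat (s : ℕ) (v : List ℕ) (φ : ConstraintCode) : Prop :=
  -- On integers, `a < b` is `a + 1 ≤ b`.
  gridLhs s v φ + φ.2.2.1.toNat ≤ gridRhs s v φ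

instance (s : ℕ) (v : List ℕ) (φ : ConstraintCode) : Decidable (GridSat s v φ) :=
  inferInstanceAs (Decidable (_ ≤ _))

/-- The value of an encoded atomic update with non-negative offset, in units of `1 / s`. -/
def gridUpdate (s : ℕ) (v : List ℕ) (u : AtomicUpdateCode) : ℕ :=
  -- The negative part of the offset is dropped; it is zero in both classes.
  u.1.elim 0 (fun y => v.getD y 0) + u.2.1 * s

/-- The encoded transition `t` can be taken from `κ` after a delay of `k`. -/
def GridEnabled (s : ℕ) (κ : ℕ × List ℕ) (t : TransitionCode) (k : ℕ) : Prop :=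
  κ.1 = t.1 ∧ ∀ φ ∈ t.2.1, GridSat s (κ.2.map (· + k)) φ

instance (s : ℕ) (κ : ℕ × List ℕ) (t : TransitionCode) (k : ℕ) :
    Decidable (GridEnabled s κ t k) :=
  inferInstanceAs (Decidable (_ ∧ _))

/-- The successors of `κ` by delays below `h`. -/
def gridSucc (s h : ℕ) (T : List TransitionCode) (κ : ℕ × List ℕ) : List (ℕ × List ℕ) :=
  T.flatMap fun t => (List.range h).flatMap fun k =>
    if GridEnabled s κ t k then
      [(t.2.2.2, t.2.2.1.map (gridUpdate s (κ.2.map (· + k))))]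
    else []

/-- The configurations reachable from `R` in at most `i` steps with delays below `h`. -/
def gridReach (s h : ℕ) (T : List TransitionCode) (R : List (ℕ × List ℕ)) (i : ℕ) :
    List (ℕ × List ℕ) :=
  (fun R => R ++ R.flatMap (gridSucc s h T))^[i] R

/-- A bound on the non-diagonal constants that are relevant for an encoded automaton. -/
def constBound (c : AutomatonCode) : ℕ := 2 * Encodable.encode c + 1

/-- A bound on the number of regions. -/
def regionBound (c : AutomatonCode) : ℕ :=
  -- States times the number of possible values of `regionSignature`.
  c.1 * 2 ^ ((c.2.1 + 1) * ((c.2.1 + 1) * (2 * constBound c + 1)))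

/-- All configurations that are relevant for the reachability problem. -/
def explore (c : AutomatonCode) : List (ℕ × List ℕ) :=
  -- One halving of the mesh for each of the `regionBound c` steps; in these units the strict bound
  -- on the delays admits exactly those up to `constBound c + 1`.
  gridReach (2 ^ regionBound c) ((constBound c + 1) * 2 ^ regionBound c + 1) c.2.2.2.1
    [(c.2.2.1, List.replicate c.2.1 0)] (regionBound c)

/-- The exploration of an encoded automaton finds an accepting state. -/
def ExploresFinal (c : AutomatonCode) : Prop :=
  ∃ κ ∈ explore c, ∃ q ∈ c.2.2.2.2, q = κ.1

/-! ### Primitive recursiveness of the exploration -/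

open Primrec in
theorem primrec_gridLhs :
    Primrec fun p : ConstraintCode × ℕ × List ℕ => gridLhs p.2.1 p.2.2 p.1 := by
  have hs : Primrec fun p : ConstraintCode × ℕ × List ℕ => p.2.1 := fst.comp snd
  have hv : Primrec fun p : ConstraintCode × ℕ × List ℕ => p.2.2 := snd.comp snd
  have hk : Primrec fun p : ConstraintCode × ℕ × List ℕ => p.1.1 := fst.comp fst
  have hx : Primrec fun p : ConstraintCode × ℕ × List ℕ => p.1.2.1.1 :=
    fst.comp (fst.comp (snd.comp fst))
  have hc : Primrec fun p : ConstraintCode × ℕ × List ℕ => p.1.2.2.2 :=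
    snd.comp (snd.comp (snd.comp fst))
  have h0 : PrimrecPred fun p : ConstraintCode × ℕ × List ℕ => p.1.1 = 0 :=
    Primrec.eq.comp hk (const 0)
  have h1 : PrimrecPred fun p : ConstraintCode × ℕ × List ℕ => p.1.1 = 1 :=
    Primrec.eq.comp hk (const 1)
  have hg : Primrec fun p : ConstraintCode × ℕ × List ℕ => p.2.2.getD p.1.2.1.1 0 :=
    (list_getD 0).comp hv hx
  have hp : Primrec fun p : ConstraintCode × ℕ × List ℕ => p.1.2.2.2.1 * p.2.1 :=
    nat_mul.comp (fst.comp hc) hs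
  have hn : Primrec fun p : ConstraintCode × ℕ × List ℕ =>
      p.2.2.getD p.1.2.1.1 0 + p.1.2.2.2.2 * p.2.1 :=
    nat_add.comp hg (nat_mul.comp (snd.comp hc) hs)
  unfold gridLhs
  exact ite h0 hg (ite h1 hp hn)

open Primrec in
theorem primrec_gridRhs :
    Primrec fun p : ConstraintCode × ℕ × List ℕ => gridRhs p.2.1 p.2.2 p.1 := by
  have hs : Primrec fun p : ConstraintCode × ℕ × List ℕ => p.2.1 := fst.comp snd
  have hv : Primrec fun p : ConstraintCode × ℕ × List ℕ => p.2.2 := snd.comp snd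
  have hk : Primrec fun p : ConstraintCode × ℕ × List ℕ => p.1.1 := fst.comp fst
  have hx : Primrec fun p : ConstraintCode × ℕ × List ℕ => p.1.2.1 :=
    fst.comp (snd.comp fst)
  have hc : Primrec fun p : ConstraintCode × ℕ × List ℕ => p.1.2.2.2.1 * p.2.1 :=
    nat_mul.comp (fst.comp (snd.comp (snd.comp (snd.comp fst)))) hs
  have h0 : PrimrecPred fun p : ConstraintCode × ℕ × List ℕ => p.1.1 = 0 :=
    Primrec.eq.comp hk (const 0)
  have h1 : PrimrecPred fun p : ConstraintCode × ℕ × List ℕ => p.1.1 = 1 :=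
    Primrec.eq.comp hk (const 1)
  have hg : Primrec fun p : ConstraintCode × ℕ × List ℕ => p.2.2.getD p.1.2.1.1 0 :=
    (list_getD 0).comp hv (fst.comp hx)
  have hn : Primrec fun p : ConstraintCode × ℕ × List ℕ =>
      p.2.2.getD p.1.2.1.2 0 + p.1.2.2.2.1 * p.2.1 :=
    nat_add.comp ((list_getD 0).comp hv (snd.comp hx)) hc
  unfold gridRhs
  exact ite h0 hc (ite h1 hg hn)

open Primrec in
theorem primrecRel_gridSat :
    PrimrecRel fun (φ : ConstraintCode) (p : ℕ × List ℕ) => GridSat p.1 p.2 φ := by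
  have hs : Primrec fun p : ConstraintCode × ℕ × List ℕ => p.1.2.2.1.toNat :=
    (dom_bool Bool.toNat).comp (fst.comp (snd.comp (snd.comp fst)))
  have hl : Primrec fun p : ConstraintCode × ℕ × List ℕ => gridLhs p.2.1 p.2.2 p.1 :=
    primrec_gridLhs
  have hr : Primrec fun p : ConstraintCode × ℕ × List ℕ => gridRhs p.2.1 p.2.2 p.1 :=
    primrec_gridRhs
  have hsum : Primrec fun p : ConstraintCode × ℕ × List ℕ =>
      gridLhs p.2.1 p.2.2 p.1 + p.1.2.2.1.toNat := nat_add.comp hl hs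
  unfold GridSat
  exact nat_le.comp hsum hr

open Primrec in
theorem primrec_gridUpdate :
    Primrec₂ fun (p : ℕ × List ℕ) (u : AtomicUpdateCode) => gridUpdate p.1 p.2 u := by
  have h : Primrec fun p : (ℕ × List ℕ) × AtomicUpdateCode =>
      (Option.casesOn p.2.1 0 (fun y => p.1.2.getD y 0) : ℕ) :=
    option_casesOn (fst.comp snd) (const 0)
      ((list_getD 0).comp (snd.comp (fst.comp fst)) snd).to₂
  refine (nat_add.comp h (nat_mul.comp (fst.comp (snd.comp snd)) (fst.comp fst))).of_eq ?_
  rintro ⟨p, _ | y, c⟩ <;> rfl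

open Primrec in
theorem primrec_delayed : Primrec fun p : (ℕ × ℕ × List ℕ) × ℕ =>
    (p.1.1, p.1.2.2.map (· + p.2)) :=
  pair (fst.comp fst) (list_map (snd.comp (snd.comp fst))
    (nat_add.comp snd (snd.comp fst)).to₂)

open Primrec in
theorem primrecPred_gridEnabled :
    PrimrecPred fun p : ((ℕ × ℕ × List ℕ) × TransitionCode) × ℕ =>
      GridEnabled p.1.1.1 p.1.1.2 p.1.2 p.2 := by
  have ht : Primrec fun p : ((ℕ × ℕ × List ℕ) × TransitionCode) × ℕ => p.1.2 := snd.comp fst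
  have hq : PrimrecPred fun p : ((ℕ × ℕ × List ℕ) × TransitionCode) × ℕ =>
      p.1.1.2.1 = p.1.2.1 :=
    Primrec.eq.comp (fst.comp (snd.comp (fst.comp fst))) (fst.comp ht)
  have hd : Primrec fun p : ((ℕ × ℕ × List ℕ) × TransitionCode) × ℕ =>
      (p.1.1.1, p.1.1.2.2.map (· + p.2)) :=
    primrec_delayed.comp (pair (fst.comp fst) snd)
  have hg : PrimrecPred fun p : ((ℕ × ℕ × List ℕ) × TransitionCode) × ℕ =>
      ∀ φ ∈ p.1.2.2.1, GridSat p.1.1.1 (p.1.1.2.2.map (· + p.2)) φ :=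
    primrecRel_gridSat.forall_mem_list.comp (fst.comp (snd.comp ht)) hd
  exact hq.and hg

open Primrec in
theorem primrec_gridFire :
    Primrec fun p : ((ℕ × ℕ × List ℕ) × TransitionCode) × ℕ =>
      if GridEnabled p.1.1.1 p.1.1.2 p.1.2 p.2 then
        [(p.1.2.2.2.2, p.1.2.2.2.1.map (gridUpdate p.1.1.1 (p.1.1.2.2.map (· + p.2))))]
      else [] := by
  have ht : Primrec fun p : ((ℕ × ℕ × List ℕ) × TransitionCode) × ℕ => p.1.2.2.2 :=
    snd.comp (snd.comp (snd.comp fst))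
  have hd : Primrec fun p : ((ℕ × ℕ × List ℕ) × TransitionCode) × ℕ =>
      (p.1.1.1, p.1.1.2.2.map (· + p.2)) :=
    primrec_delayed.comp (pair (fst.comp fst) snd)
  have hup : Primrec fun p : ((ℕ × ℕ × List ℕ) × TransitionCode) × ℕ =>
      p.1.2.2.2.1.map (gridUpdate p.1.1.1 (p.1.1.2.2.map (· + p.2))) :=
    list_map (fst.comp ht) (primrec_gridUpdate.comp (hd.comp fst) snd).to₂
  have hcons : Primrec fun p : ((ℕ × ℕ × List ℕ) × TransitionCode) × ℕ =>
      [(p.1.2.2.2.2, p.1.2.2.2.1.map (gridUpdate p.1.1.1 (p.1.1.2.2.map (· + p.2))))] :=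
    list_cons.comp (pair (snd.comp ht) hup) (const [])
  exact ite primrecPred_gridEnabled hcons (const [])

open Primrec in
theorem primrec_gridSucc :
    Primrec₂ fun (p : (ℕ × ℕ) × List TransitionCode) (κ : ℕ × List ℕ) =>
      gridSucc p.1.1 p.1.2 p.2 κ := by
  have hin : Primrec₂ fun (p : ((ℕ × ℕ) × List TransitionCode) × (ℕ × List ℕ))
      (t : TransitionCode) => (List.range p.1.1.2).flatMap fun k =>
        if GridEnabled p.1.1.1 p.2 t k then
          [(t.2.2.2, t.2.2.1.map (gridUpdate p.1.1.1 (p.2.2.map (· + k))))] else [] := by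
    refine list_flatMap (list_range.comp (snd.comp (fst.comp (fst.comp fst)))) ?_
    exact (primrec_gridFire.comp (pair (pair (pair (fst.comp (fst.comp (fst.comp
      (fst.comp fst)))) (snd.comp (fst.comp fst))) (snd.comp fst)) snd)).to₂
  exact list_flatMap (snd.comp fst) hin

open Primrec in
theorem primrec_constBound : Primrec constBound :=
  succ.comp (nat_mul.comp (const 2) Primrec.encode)

open Primrec in
theorem primrec_two_pow : Primrec fun n : ℕ => 2 ^ n :=
  (nat_rec₁ (f := fun _ m => m * 2) 1 (nat_mul.comp snd (const 2)).to₂).of_eq fun n => by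
    induction n with
    | zero => rfl
    | succ n ih => rw [pow_succ, ← ih]

open Primrec in
theorem primrec_regionBound : Primrec regionBound := by
  have hn : Primrec fun c : AutomatonCode => c.2.1 + 1 := succ.comp (fst.comp snd)
  exact nat_mul.comp fst (primrec_two_pow.comp (nat_mul.comp hn (nat_mul.comp hn
    (succ.comp (nat_mul.comp (const 2) primrec_constBound)))))

open Primrec in
theorem primrec_explore : Primrec explore := by
  have hs : Primrec fun c : AutomatonCode => 2 ^ regionBound c :=
    primrec_two_pow.comp primrec_regionBound
  have hh : Primrec fun c : AutomatonCode => (constBound c + 1) * 2 ^ regionBound c + 1 :=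
    succ.comp (nat_mul.comp (succ.comp primrec_constBound) hs)
  have hT : Primrec fun c : AutomatonCode => c.2.2.2.1 := fst.comp (snd.comp (snd.comp snd))
  have hrep : Primrec fun n : ℕ => List.replicate n 0 :=
    (list_map list_range (const 0).to₂).of_eq fun n => by simp
  have hR : Primrec fun c : AutomatonCode => [(c.2.2.1, List.replicate c.2.1 0)] :=
    list_cons.comp (pair (fst.comp (snd.comp snd)) (hrep.comp (fst.comp snd))) (const [])
  have hp : Primrec fun c : AutomatonCode =>
      ((2 ^ regionBound c, (constBound c + 1) * 2 ^ regionBound c + 1), c.2.2.2.1) :=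
    pair (pair hs hh) hT
  have hstep : Primrec₂ fun (c : AutomatonCode) (R : List (ℕ × List ℕ)) =>
      R ++ R.flatMap (gridSucc (2 ^ regionBound c)
        ((constBound c + 1) * 2 ^ regionBound c + 1) c.2.2.2.1) :=
    list_append.comp snd (list_flatMap snd
      (primrec_gridSucc.comp (hp.comp (fst.comp fst)) snd).to₂)
  exact nat_iterate primrec_regionBound hR hstep

open Primrec in
theorem primrecPred_exploresFinal : PrimrecPred ExploresFinal := by
  have h1 : PrimrecRel fun (L : List ℕ) (κ : ℕ × List ℕ) => ∃ q ∈ L, q = κ.1 :=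
    PrimrecRel.exists_mem_list (R := fun (q : ℕ) (κ : ℕ × List ℕ) => q = κ.1)
      (Primrec.eq.comp fst (fst.comp snd))
  have h2 := PrimrecRel.exists_mem_list
    (R := fun (κ : ℕ × List ℕ) (L : List ℕ) => ∃ q ∈ L, q = κ.1) (h1.comp snd fst)
  exact h2.comp primrec_explore (snd.comp (snd.comp (snd.comp snd)))

/-! ### Region equivalence -/

/-- Two real valuations are equivalent if they satisfy the same non-diagonal constraints with
constants up to `N`, the same diagonal constraints with constants smaller than `D` in absolute
value, and the same diagonal constraints on clocks that are at most `N`. -/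
structure RegionEquiv {X : Type} (N D : ℕ) (v w : X → ℝ) : Prop where
  le_const : ∀ x, ∀ c : ℕ, c ≤ N → (v x ≤ c ↔ w x ≤ c)
  const_le : ∀ x, ∀ c : ℕ, c ≤ N → (c ≤ v x ↔ c ≤ w x)
  -- The first alternative serves diagonal guards, the second orders the moments at which clocks
  -- reach constants up to `N`. It mentions only `v`, as `le_const` at `N` transfers it to `w`.
  sub_le : ∀ x y, ∀ d : ℤ, |d| < D ∨ (v x ≤ N ∧ v y ≤ N) → (v x - v y ≤ d ↔ w x - w y ≤ d)

namespace RegionEquiv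

variable {X : Type} {N D : ℕ} {v w : X → ℝ}

theorem refl (v : X → ℝ) : RegionEquiv N D v v :=
  ⟨fun _ _ _ => Iff.rfl, fun _ _ _ => Iff.rfl, fun _ _ _ _ => Iff.rfl⟩

/-- Pulling constraints back over updates produces integers outside `0, …, N`. Negative ones are
decided by non-negativity of the clocks, those above `N` by the assumption that the clock is at most
`N`. -/
theorem le_int (h : RegionEquiv N D v w) (hv : ∀ x, 0 ≤ v x) (hw : ∀ x, 0 ≤ w x) (x : X) (z : ℤ)
    (hz : z ≤ N ∨ v x ≤ N) : v x ≤ z ↔ w x ≤ z := by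
  rcases lt_or_ge z 0 with hz0 | hz0
  · have : (z : ℝ) < 0 := by exact_mod_cast hz0
    constructor <;> intro h' <;> linarith [hv x, hw x]
  · lift z to ℕ using hz0
    by_cases hzN : z ≤ N
    · exact_mod_cast h.le_const x z hzN
    · have hx := hz.resolve_left (by exact_mod_cast hzN)
      have hx' := (h.le_const x N le_rfl).1 hx
      have : (N : ℝ) ≤ z := by exact_mod_cast (not_le.1 hzN).le
      push_cast
      exact ⟨fun _ => hx'.trans this, fun _ => hx.trans this⟩

theorem int_le (h : RegionEquiv N D v w) (hv : ∀ x, 0 ≤ v x) (hw : ∀ x, 0 ≤ w x) (x : X) (z : ℤ)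
    (hz : z ≤ N ∨ v x ≤ N) : z ≤ v x ↔ z ≤ w x := by
  rcases lt_or_ge z 0 with hz0 | hz0
  · have : (z : ℝ) < 0 := by exact_mod_cast hz0
    constructor <;> intro h' <;> linarith [hv x, hw x]
  · lift z to ℕ using hz0
    by_cases hzN : z ≤ N
    · exact_mod_cast h.const_le x z hzN
    · have hx := hz.resolve_left (by exact_mod_cast hzN)
      have hx' := (h.le_const x N le_rfl).1 hx
      have : (N : ℝ) < z := by exact_mod_cast (not_le.1 hzN)
      push_cast
      constructor <;> intro h' <;> linarith

end RegionEquiv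

/-- A real can be transferred between two finite families with the same order type. -/
theorem exists_same_cut {ι : Type*} (s : Finset ι) (a b : ι → ℝ)
    (hab : ∀ i ∈ s, ∀ j ∈ s, (a i ≤ a j ↔ b i ≤ b j)) (δ : ℝ) (h0 : ∃ i ∈ s, a i ≤ δ) :
    ∃ δ' : ℝ, (∃ i ∈ s, ∃ j ∈ s, δ' = (b i + b j) / 2 ∨ δ' = b i + 1) ∧
      ∀ i ∈ s, (a i ≤ δ ↔ b i ≤ δ') ∧ (δ ≤ a i ↔ δ' ≤ b i) := by
  by_cases he : ∃ j ∈ s, a j = δ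
  · obtain ⟨j, hj, rfl⟩ := he
    exact ⟨b j, ⟨j, hj, j, hj, Or.inl (by ring)⟩,
      fun i hi => ⟨hab i hi j hj, hab j hj i hi⟩⟩
  push Not at he
  -- Now `δ` lies strictly inside a gap: `a j` is its lower end, and `a k`, if there is one, its
  -- upper end. The midpoint of `b j` and `b k`, or `b j + 1`, lies in the corresponding gap.
  obtain ⟨j, hj, hjmax⟩ := (s.filter (a · ≤ δ)).exists_max_image a
    (by obtain ⟨i, hi, hi'⟩ := h0; exact ⟨i, by simp [hi, hi']⟩)
  simp only [Finset.mem_filter] at hj hjmax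
  rcases (s.filter (δ ≤ a ·)).eq_empty_or_nonempty with hU | hU
  · refine ⟨b j + 1, ⟨j, hj.1, j, hj.1, Or.inr rfl⟩, fun i hi => ?_⟩
    have hi1 : ¬ δ ≤ a i := fun h => by
      have : i ∈ s.filter (δ ≤ a ·) := by simp [hi, h]
      simp [hU] at this
    have hi2 := (hab i hi j hj.1).1 (hjmax i ⟨hi, (not_le.1 hi1).le⟩)
    exact ⟨iff_of_true (not_le.1 hi1).le (by linarith), iff_of_false hi1 (by linarith)⟩
  · obtain ⟨k, hk, hkmin⟩ := Finset.exists_min_image _ a hU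
    simp only [Finset.mem_filter] at hk hkmin
    have hjk : b j < b k := by
      have h1 : a j < δ := lt_of_le_of_ne hj.2 (he j hj.1)
      exact not_le.1 fun h => absurd ((hab k hk.1 j hj.1).2 h) (by linarith [hk.2])
    refine ⟨(b j + b k) / 2, ⟨j, hj.1, k, hk.1, Or.inl rfl⟩, fun i hi => ?_⟩
    rcases le_total (a i) δ with h | h
    · have h1 := (hab i hi j hj.1).1 (hjmax i ⟨hi, h⟩)
      exact ⟨iff_of_true h (by linarith),
        iff_of_false (fun h' => he i hi (le_antisymm h h')) (by linarith)⟩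
    · have h1 := (hab k hk.1 i hi).1 (hkmin i ⟨hi, h⟩)
      exact ⟨iff_of_false (fun h' => he i hi (le_antisymm h' h)) (by linarith),
        iff_of_true h (by linarith)⟩

namespace RegionEquiv

variable {X : Type} {N D : ℕ} {v w : X → ℝ}

/-- Delays can be transferred between equivalent valuations. The delay is `0`, a difference
`c - w x`, the midpoint of two such numbers, or such a number plus `1`. -/
theorem exists_delay [Fintype X] (h : RegionEquiv N D v w) (hw : ∀ x, 0 ≤ w x)
    (δ : ℝ) (hδ : 0 ≤ δ) (G : ℝ → Prop) (hG0 : G 0)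
    (hG : ∀ x, ∀ c : ℕ, c ≤ N → w x ≤ c → G (c - w x)) :
    ∃ δ' : ℝ, 0 ≤ δ' ∧ δ' ≤ N + 1 ∧
      (∃ r r', G r ∧ G r' ∧ (δ' = (r + r') / 2 ∨ δ' = r + 1)) ∧
      RegionEquiv N D (fun x => v x + δ) (fun x => w x + δ') := by
  classical
  -- Landmarks: `none` is the delay `0`, and `some (x, c)` the delay after which `x` equals `c`.
  -- Only those not yet passed are kept in `s`; their clocks are at most `N`, so `sub_le` shows that
  -- `v` and `w` order them alike.
  let a : Option (X × Fin (N + 1)) → ℝ := fun i => i.elim 0 fun p => (p.2 : ℕ) - v p.1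
  let b : Option (X × Fin (N + 1)) → ℝ := fun i => i.elim 0 fun p => (p.2 : ℕ) - w p.1
  let s : Finset (Option (X × Fin (N + 1))) := Finset.univ.filter fun i => 0 ≤ a i
  have hle : ∀ c : Fin (N + 1), (c : ℕ) ≤ N := fun c => Nat.lt_succ_iff.1 c.2
  have hle' : ∀ c : Fin (N + 1), ((c : ℕ) : ℝ) ≤ N := fun c => by exact_mod_cast hle c
  have hb : ∀ i ∈ s, 0 ≤ b i ∧ b i ≤ N ∧ G (b i) := by
    rintro (_ | ⟨x, c⟩) hi
    · exact ⟨le_rfl, Nat.cast_nonneg N, hG0⟩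
    · have hi : v x ≤ (c : ℕ) := sub_nonneg.1 (Finset.mem_filter.1 hi).2
      have h1 := (h.le_const x c (hle c)).1 hi
      simp only [b, Option.elim, sub_nonneg]
      exact ⟨h1, by linarith [hle' c, hw x], hG x c (hle c) h1⟩
  have hab : ∀ i ∈ s, ∀ j ∈ s, (a i ≤ a j ↔ b i ≤ b j) := by
    intro i hi j hj
    have hbi := (hb i hi).1
    have hbj := (hb j hj).1
    simp only [s, Finset.mem_filter] at hi hj
    rcases i with _ | ⟨x, c⟩
    · exact iff_of_true hj.2 hbj
    rcases j with _ | ⟨y, c'⟩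
    · simp only [a, b, Option.elim, sub_nonpos]
      exact h.const_le x c (hle c)
    · simp only [a, b, Option.elim, sub_nonneg] at hi hj ⊢
      have := h.sub_le y x ((c' : ℕ) - (c : ℕ) : ℤ)
        (Or.inr ⟨hj.2.trans (hle' c'), hi.2.trans (hle' c)⟩)
      push_cast at this
      constructor <;> intro h'
      · linarith [this.1 (by linarith)]
      · linarith [this.2 (by linarith)]
  have hnone : none ∈ s := by simp [s, a]
  obtain ⟨δ', ⟨i, hi, j, hj, hδ'⟩, hcut⟩ := exists_same_cut s a b hab δ ⟨none, hnone, hδ⟩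
  have hδ'0 : 0 ≤ δ' := (hcut none hnone).1.1 hδ
  have hcut' : ∀ x, ∀ c : ℕ, c ≤ N →
      ((c - v x ≤ δ ↔ c - w x ≤ δ') ∧ (δ ≤ c - v x ↔ δ' ≤ c - w x)) := by
    intro x c hc
    by_cases hx : v x ≤ c
    · have := hcut (some (x, ⟨c, Nat.lt_succ_iff.2 hc⟩)) (by simp [s, a, hx])
      exact this
    · have hx' := mt (h.le_const x c hc).2 hx
      rw [not_le] at hx hx'
      exact ⟨iff_of_true (by linarith) (by linarith), iff_of_false (by linarith) (by linarith)⟩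
  refine ⟨δ', hδ'0, ?_, ⟨b i, b j, (hb i hi).2.2, (hb j hj).2.2, hδ'⟩, ?_, ?_, ?_⟩
  · have h1 := (hb i hi).2.1
    have h2 := (hb j hj).2.1
    rcases hδ' with rfl | rfl <;> linarith
  · intro x c hc
    rw [← le_sub_iff_add_le', ← le_sub_iff_add_le']
    exact (hcut' x c hc).2
  · intro x c hc
    rw [← sub_le_iff_le_add', ← sub_le_iff_le_add']
    exact (hcut' x c hc).1
  · intro x y d hd
    simp only [add_sub_add_right_eq_sub]
    exact h.sub_le x y d (hd.imp_right fun hxy => ⟨by linarith [hxy.1], by linarith [hxy.2]⟩)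

/-- The value of an atomic update at a real valuation. -/
def _root_.UTA.AtomicUpdate.evalReal {X : Type} (v : X → ℝ) : AtomicUpdate X → ℝ
  | .const c => (c : ℝ)
  | .shift y d => v y + (d : ℝ)

/-- Atomic updates that are compatible with region equivalence: the constant is small, and offsets
are non-negative, and zero if diagonal constraints are to be preserved. -/
def _root_.UTA.AtomicUpdate.Tame {X : Type} (N D : ℕ) : AtomicUpdate X → Prop
  | .const c => c + D ≤ N
  | .shift _ d => 0 ≤ d ∧ (D = 0 ∨ d = 0)

/-- A constraint on the new values is one on the old values with another constant. For single
clocks, non-negative offsets keep it at most `N`. For a difference with `|k| < D`, offsets vanish,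
so either `k` is unchanged or it is combined with an assigned `e`, where `e + D ≤ N` leaves room. If
instead both new values are at most `N`, then so are the shifted old clocks. -/
theorem update (h : RegionEquiv N D v w) (hv : ∀ x, 0 ≤ v x) (hw : ∀ x, 0 ≤ w x)
    (up : Update X) (hup : ∀ x, (up x).Tame N D) :
    RegionEquiv N D (fun x => (up x).evalReal v) (fun x => (up x).evalReal w) := by
  refine ⟨fun x c hc => ?_, fun x c hc => ?_, fun x y k hk => ?_⟩
  · have hx := hup x
    cases hux : up x with
    | const e => rfl
    | shift z d =>
      simp only [hux, AtomicUpdate.Tame, AtomicUpdate.evalReal] at hx ⊢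
      have := h.le_int hv hw z (c - d) (Or.inl (by omega))
      push_cast at this
      rwa [le_sub_iff_add_le, le_sub_iff_add_le] at this
  · have hx := hup x
    cases hux : up x with
    | const e => rfl
    | shift z d =>
      simp only [hux, AtomicUpdate.Tame, AtomicUpdate.evalReal] at hx ⊢
      have := h.int_le hv hw z (c - d) (Or.inl (by omega))
      push_cast at this
      rwa [sub_le_iff_le_add, sub_le_iff_le_add] at this
  · have hx := hup x
    have hy := hup y
    rw [abs_lt] at hk
    cases hux : up x with
    | const e =>
      cases huy : up y with
      | const e' => rfl
      | shift z d =>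
        simp only [hux, huy, AtomicUpdate.Tame, AtomicUpdate.evalReal] at hx hy hk ⊢
        have := h.int_le hv hw z (e - d - k) (hk.imp (by omega) fun hk => by
          have : (0 : ℝ) ≤ d := by exact_mod_cast hy.1
          linarith [hk.2])
        push_cast at this
        constructor <;> intro h'
        · linarith [this.1 (by linarith)]
        · linarith [this.2 (by linarith)]
    | shift z d =>
      cases huy : up y with
      | const e =>
        simp only [hux, huy, AtomicUpdate.Tame, AtomicUpdate.evalReal] at hx hy hk ⊢
        have := h.le_int hv hw z (k + e - d) (hk.imp (by omega) fun hk => by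
          have : (0 : ℝ) ≤ d := by exact_mod_cast hx.1
          linarith [hk.1])
        push_cast at this
        constructor <;> intro h'
        · linarith [this.1 (by linarith)]
        · linarith [this.2 (by linarith)]
      | shift z' d' =>
        simp only [hux, huy, AtomicUpdate.Tame, AtomicUpdate.evalReal] at hx hy hk ⊢
        have := h.sub_le z z' (k - d + d') (hk.imp (fun hk => by rw [abs_lt]; omega) fun hk => by
          have h1 : (0 : ℝ) ≤ d := by exact_mod_cast hx.1
          have h2 : (0 : ℝ) ≤ d' := by exact_mod_cast hy.1
          constructor <;> linarith [hk.1, hk.2])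
        push_cast at this
        constructor <;> intro h'
        · linarith [this.1 (by linarith)]
        · linarith [this.2 (by linarith)]

/-- Satisfaction of a constraint by a real valuation. -/
def _root_.UTA.Constraint.SatReal {X : Type} (v : X → ℝ) : Constraint X → Prop
  | .upper x s c => s.Holds (v x) c
  | .lower c s x => s.Holds c (v x)
  | .diag x y s d => s.Holds (v x - v y) d

/-- Constraints that are compatible with region equivalence. -/
def _root_.UTA.Constraint.Tame {X : Type} (N D : ℕ) : Constraint X → Prop
  | .upper _ _ c => c ≤ N
  | .lower c _ _ => c ≤ N
  | .diag _ _ _ d => |d| < D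

theorem satReal_iff (h : RegionEquiv N D v w) {φ : Constraint X} (hφ : φ.Tame N D) :
    φ.SatReal v ↔ φ.SatReal w := by
  rcases φ with ⟨x, _ | _, c⟩ | ⟨c, _ | _, x⟩ | ⟨x, y, _ | _, d⟩ <;>
    simp only [Constraint.Tame, Constraint.SatReal, Cmp.Holds] at hφ ⊢
  · rw [← not_le, ← not_le, h.const_le x c hφ]
  · exact h.le_const x c hφ
  · rw [← not_le, ← not_le, h.le_const x c hφ]
  · exact h.const_le x c hφ
  -- The strict constraint is the negation of the weak one with the clocks swapped.
  · have := h.sub_le y x (-d) (Or.inl (by rwa [abs_neg]))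
    push_cast at this
    constructor <;> intro h' <;> by_contra h''
    · linarith [this.2 (by linarith)]
    · linarith [this.1 (by linarith)]
  · exact h.sub_le x y d (Or.inl hφ)

end RegionEquiv

/-! ### Finiteness of the number of regions -/

open Classical in
/-- The truth values of all constraints with constants up to `N`, where `none` is a clock that
is always `0`. -/
noncomputable def regionSignature {X : Type} (N : ℕ) (v : X → ℝ) :
    Option X → Option X → Fin (2 * N + 1) → Bool :=
  fun x y d => decide (x.elim 0 v - y.elim 0 v ≤ (d : ℕ) - (N : ℝ))

/-- Constants with `|d| > N` need no record: they matter only for two clocks in `[0, N]`, whose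
difference lies in `[-N, N]`. -/
theorem regionEquiv_of_signature_eq {X : Type} {N D : ℕ} {v w : X → ℝ} (hD : D ≤ N)
    (hv : ∀ x, 0 ≤ v x) (hw : ∀ x, 0 ≤ w x)
    (h : regionSignature N v = regionSignature N w) : RegionEquiv N D v w := by
  have key : ∀ (x y : Option X) (d : ℤ), |d| ≤ N →
      (x.elim 0 v - y.elim 0 v ≤ d ↔ x.elim 0 w - y.elim 0 w ≤ d) := by
    intro x y d hd
    rw [abs_le] at hd
    have := congrFun (congrFun (congrFun h x) y) ⟨(d + N).toNat, by omega⟩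
    simp only [regionSignature, decide_eq_decide] at this
    have hc : (((d + N).toNat : ℕ) : ℝ) = d + N := by
      have : (((d + N).toNat : ℕ) : ℤ) = d + N := Int.toNat_of_nonneg (by omega)
      exact_mod_cast this
    simpa [hc] using this
  have hle : ∀ x, ∀ c : ℕ, c ≤ N → (v x ≤ c ↔ w x ≤ c) := fun x c hc => by
    simpa using key (some x) none c (by simpa using hc)
  refine ⟨hle, fun x c hc => ?_, fun x y d hd => ?_⟩
  · simpa using key none (some x) (-c) (by simpa using hc)
  · rcases le_or_gt |d| N with hdN | hdN
    · exact key (some x) (some y) d hdN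
    · have hd' := hd.resolve_left (by omega)
      have hx := (hle x N le_rfl).1 hd'.1
      have hy := (hle y N le_rfl).1 hd'.2
      rcases lt_abs.1 hdN with h1 | h1
      · have : (N : ℝ) < d := by exact_mod_cast h1
        exact iff_of_true (by linarith [hv y]) (by linarith [hw y])
      · have : (N : ℝ) < -d := by exact_mod_cast h1
        exact iff_of_false (by linarith [hv x]) (by linarith [hw x])

/-! ### State-based guards -/

namespace Automaton

theorem le_maxConstant {A : Automaton} {k : ℕ} (h : k ∈ A.constants) : k ≤ A.maxConstant := by
  unfold maxConstant
  revert h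
  induction A.constants with
  | nil => simp
  | cons a l ih =>
    intro h
    rcases List.mem_cons.1 h with rfl | h
    · exact le_max_left _ _
    · exact (ih h).trans (le_max_right _ _)

theorem natAbs_const_le_maxConstant {A : Automaton} {t : Transition A.State A.Clock}
    (ht : t ∈ A.trans) {φ : Constraint A.Clock} (hφ : φ ∈ t.guard) :
    φ.const.natAbs ≤ A.maxConstant :=
  le_maxConstant (List.mem_flatMap.2 ⟨t, ht, List.mem_append_left _ (List.mem_map_of_mem hφ)⟩)

theorem natAbs_offset_le_maxConstant {A : Automaton} {t : Transition A.State A.Clock}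
    (ht : t ∈ A.trans) (x : A.Clock) : (t.update x).offset.natAbs ≤ A.maxConstant :=
  le_maxConstant (List.mem_flatMap.2 ⟨t, ht, List.mem_append_right _
    (List.mem_ofFn.2 ⟨x, rfl⟩)⟩)

/-- No clock is shifted by a negative number. -/
def ShiftsNonneg (A : Automaton) : Prop :=
  ∀ t ∈ A.trans, ∀ x y d, t.update x = .shift y d → 0 ≤ d

/-- No clock is shifted by a non-zero number. -/
def ShiftsZero (A : Automaton) : Prop :=
  ∀ t ∈ A.trans, ∀ x y d, t.update x = .shift y d → d = 0

theorem DiagonalFreeIncrementing.shiftsNonneg {A : Automaton} (h : A.DiagonalFreeIncrementing) :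
    A.ShiftsNonneg := by
  intro t ht x y d hx
  rcases (h t ht).2 x with ⟨c, hc⟩ | ⟨y', d', hd', h'⟩
  · simp [hc] at hx
  · rw [h'] at hx
    cases hx
    exact hd'

theorem DiagonalCopying.shiftsZero {A : Automaton} (h : A.DiagonalCopying) : A.ShiftsZero := by
  intro t ht x y d hx
  rcases h t ht x with ⟨c, hc⟩ | ⟨y', h'⟩
  · simp [hc] at hx
  · rw [h'] at hx
    cases hx
    rfl

theorem ShiftsZero.shiftsNonneg {A : Automaton} (h : A.ShiftsZero) : A.ShiftsNonneg :=
  fun t ht x y d hx => (h t ht x y d hx).ge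

/-- The bounds on the constants of state-based guards. -/
def Bounded (A : Automaton) (φ : Constraint A.Clock) : Prop :=
  -- Recording `ShiftsZero` makes the invariant inductive for both classes at once: in class (a) no
  -- diagonal constraint ever arises, in class (b) all shifts are zero.
  (φ.IsDiagonal → A.ShiftsZero ∧ ∃ t ∈ A.trans, ∃ ψ ∈ t.guard, ψ.const = φ.const) ∧
    (¬ φ.IsDiagonal → φ.const ≤ 2 * (A.maxConstant : ℤ))

/-- Non-negative shifts never raise non-diagonal constants. A diagonal constraint keeps its constant
under copying; when one clock is assigned `e`, it becomes non-diagonal with constant `c + e` or `e -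
c`. This is the source of the factor `2`. -/
theorem Bounded.wp {A : Automaton} (hA : A.ShiftsNonneg) {φ ψ : Constraint A.Clock}
    (hφ : A.Bounded φ) {t : Transition A.State A.Clock} (ht : t ∈ A.trans)
    (h : Constraint.wp t.update φ = some ψ) : A.Bounded ψ := by
  rcases φ with ⟨x, s, c⟩ | ⟨c, s, x⟩ | ⟨x, y, s, c⟩
  · have hc := hφ.2 (by simp [Constraint.IsDiagonal])
    cases hx : t.update x with
    | const e => simp [Constraint.wp, hx] at h
    | shift z d =>
      have hd := hA t ht x z d hx
      simp only [Constraint.wp, hx, Option.ite_none_right_eq_some, Option.some.injEq] at h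
      obtain ⟨h0, rfl⟩ := h
      simp only [Bounded, Constraint.IsDiagonal, Constraint.const] at hc ⊢
      refine ⟨False.elim, fun _ => ?_⟩
      omega
  · have hc := hφ.2 (by simp [Constraint.IsDiagonal])
    cases hx : t.update x with
    | const e => simp [Constraint.wp, hx] at h
    | shift z d =>
      have hd := hA t ht x z d hx
      simp only [Constraint.wp, hx, Option.ite_none_right_eq_some, Option.some.injEq] at h
      obtain ⟨h0, rfl⟩ := h
      simp only [Bounded, Constraint.IsDiagonal, Constraint.const] at hc ⊢
      refine ⟨False.elim, fun _ => ?_⟩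
      omega
  · obtain ⟨hZ, t', ht', ψ', hψ', hc⟩ := hφ.1 trivial
    have hcM := natAbs_const_le_maxConstant ht' hψ'
    have hxM := natAbs_offset_le_maxConstant ht x
    have hyM := natAbs_offset_le_maxConstant ht y
    rw [hc] at hcM
    cases hx : t.update x with
    | const e =>
      cases hy : t.update y with
      | const e' => simp [Constraint.wp, hx, hy] at h
      | shift z d =>
        have hd := hZ t ht y z d hy
        simp only [Constraint.wp, hx, hy, Option.ite_none_right_eq_some, Option.some.injEq] at h
        obtain ⟨h0, rfl⟩ := h
        simp only [Bounded, Constraint.IsDiagonal, Constraint.const, hx,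
          AtomicUpdate.offset] at hcM hxM ⊢
        refine ⟨False.elim, fun _ => ?_⟩
        omega
    | shift z d =>
      have hd := hZ t ht x z d hx
      cases hy : t.update y with
      | const e =>
        simp only [Constraint.wp, hx, hy, Option.ite_none_right_eq_some, Option.some.injEq] at h
        obtain ⟨h0, rfl⟩ := h
        simp only [Bounded, Constraint.IsDiagonal, Constraint.const, hy,
          AtomicUpdate.offset] at hcM hyM ⊢
        refine ⟨False.elim, fun _ => ?_⟩
        omega
      | shift z' d' =>
        have hd' := hZ t ht y z' d' hy
        simp only [Constraint.wp, hx, hy, Option.ite_none_left_eq_some, Option.some.injEq] at h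
        obtain ⟨h0, rfl⟩ := h
        refine ⟨fun _ => ⟨hZ, t', ht', ψ', hψ', ?_⟩, fun h => (h trivial).elim⟩
        rw [hc]
        simp [Constraint.const, hd, hd']

theorem bounded_of_mem_guard {A : Automaton} (hA : A.DiagonalFreeIncrementing ∨ A.DiagonalCopying)
    {t : Transition A.State A.Clock} (ht : t ∈ A.trans) {φ : Constraint A.Clock}
    (hφ : φ ∈ t.guard) : A.Bounded φ := by
  refine ⟨fun hd => ⟨hA.elim (fun h => ((h t ht).1 φ hφ hd).elim) (·.shiftsZero),
    t, ht, φ, hφ, rfl⟩, fun _ => ?_⟩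
  have := natAbs_const_le_maxConstant ht hφ
  omega

theorem bounded_of_mem_stateGuards {A : Automaton}
    (hA : A.DiagonalFreeIncrementing ∨ A.DiagonalCopying) (i : ℕ) (q : A.State) :
    ∀ φ ∈ A.stateGuards i q, A.Bounded φ := by
  have hS : A.ShiftsNonneg := hA.elim (·.shiftsNonneg) (·.shiftsZero.shiftsNonneg)
  induction i generalizing q with
  | zero =>
    rintro φ ⟨t, ht, -, hφ | ⟨ψ, ⟨x, rfl⟩, hψ⟩⟩
    · exact bounded_of_mem_guard hA ht hφ
    · exact Bounded.wp hS ⟨False.elim, fun _ => by simp [Constraint.const]⟩ ht hψ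
  | succ i ih =>
    rintro φ ⟨t, ht, -, hφ | ⟨ψ, hψ, hψφ⟩⟩
    · exact ih q φ hφ
    · exact (ih t.tgt ψ hψ).wp hS ht hψφ

/-- Stage `i + 1` inherits stage `i` only through an outgoing transition; at states without one, all
stages are empty. -/
theorem stateGuards_subset_succ (A : Automaton) (i : ℕ) (q : A.State) :
    A.stateGuards i q ⊆ A.stateGuards (i + 1) q := by
  intro φ hφ
  have hsrc : ∃ t ∈ A.trans, t.src = q := by
    cases i <;> exact hφ.imp fun t ht => ⟨ht.1, ht.2.1⟩
  obtain ⟨t, ht, htq⟩ := hsrc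
  exact ⟨t, ht, htq, Or.inl hφ⟩

theorem _root_.UTA.finite_setOf_natAbs_const_le (X : Type) [Finite X] (K : ℕ) :
    {φ : Constraint X | φ.const.natAbs ≤ K}.Finite := by
  let s : Bool → Cmp := fun b => if b then .lt else .le
  have hs : ∀ c, ∃ b, s b = c := by
    rintro (_ | _)
    exacts [⟨true, rfl⟩, ⟨false, rfl⟩]
  refine (((Set.finite_range fun p : X × Bool × Fin (K + 1) =>
      Constraint.upper p.1 (s p.2.1) p.2.2).union
    (Set.finite_range fun p : X × Bool × Fin (K + 1) =>
      Constraint.lower p.2.2 (s p.2.1) p.1)).union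
    (Set.finite_range fun p : X × X × Bool × Set.Icc (-K : ℤ) K =>
      Constraint.diag p.1 p.2.1 (s p.2.2.1) p.2.2.2)).subset ?_
  rintro (⟨x, c, k⟩ | ⟨k, c, x⟩ | ⟨x, y, c, d⟩) h <;> obtain ⟨b, rfl⟩ := hs c <;>
    simp only [Constraint.const, Set.mem_ofPred_eq] at h
  · exact Or.inl (Or.inl ⟨(x, b, ⟨k, by omega⟩), rfl⟩)
  · exact Or.inl (Or.inr ⟨(x, b, ⟨k, by omega⟩), rfl⟩)
  · exact Or.inr ⟨(x, y, b, ⟨d, by simp only [Set.mem_Icc]; omega⟩), rfl⟩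

/-- All stages are families of subsets of one finite set, so two of them agree at every state
simultaneously; by monotonicity the stages between them agree too. -/
theorem exists_stateGuards_succ_eq {A : Automaton}
    (hA : A.DiagonalFreeIncrementing ∨ A.DiagonalCopying) :
    ∃ k, ∀ q, A.stateGuards (k + 1) q = A.stateGuards k q := by
  let S := {φ : Constraint A.Clock | φ.const.natAbs ≤ 2 * A.maxConstant}
  have hS : Finite S := finite_setOf_natAbs_const_le _ _
  have hsub : ∀ i q, A.stateGuards i q ⊆ S := by
    intro i q φ hφ
    have hb := bounded_of_mem_stateGuards hA i q φ hφ
    change φ.const.natAbs ≤ 2 * A.maxConstant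
    by_cases hd : φ.IsDiagonal
    · obtain ⟨-, t, ht, ψ, hψ, h⟩ := hb.1 hd
      have := natAbs_const_le_maxConstant ht hψ
      omega
    · have := hb.2 hd
      rcases φ with ⟨x, c, k⟩ | ⟨k, c, x⟩ | ⟨x, y, c, d⟩
      · simp only [Constraint.const] at *; omega
      · simp only [Constraint.const] at *; omega
      · exact (hd trivial).elim
  have hmono : ∀ q, Monotone fun i => A.stateGuards i q := fun q =>
    monotone_nat_of_le_succ fun i => A.stateGuards_subset_succ i q
  let F : ℕ → A.State → Set S := fun i q => {φ | φ.1 ∈ A.stateGuards i q}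
  have key : ∀ i j, i < j → F i = F j →
      ∃ k, ∀ q, A.stateGuards (k + 1) q = A.stateGuards k q := by
    refine fun i j hij h => ⟨i, fun q => (A.stateGuards_subset_succ i q).antisymm' fun φ hφ => ?_⟩
    have h1 := hmono q hij hφ
    have h2 : (⟨φ, hsub j q h1⟩ : S) ∈ F i q := by
      rw [h]
      exact h1
    exact h2
  obtain ⟨i, j, hij, h⟩ := Finite.exists_ne_map_eq_of_infinite F
  rcases lt_or_gt_of_ne hij with hlt | hlt
  exacts [key i j hlt h, key j i hlt h.symm]

end Automaton

/-! ### Short runs -/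

namespace Automaton

/-- The guards and updates are compatible with region equivalence. -/
def Tame (A : Automaton) (N D : ℕ) : Prop :=
  ∀ t ∈ A.trans, (∀ φ ∈ t.guard, φ.Tame N D) ∧ ∀ x, (t.update x).Tame N D

theorem _root_.UTA.Constraint.sat_iff {X : Type} (v : Valuation X) (φ : Constraint X) :
    φ.Sat v ↔ φ.SatReal fun x => (v x : ℝ) := by
  cases φ <;> rfl

theorem _root_.UTA.AtomicUpdate.eval_eq {X : Type} (v : Valuation X) (u : AtomicUpdate X) :
    u.eval v = u.evalReal fun x => (v x : ℝ) := by
  cases u <;> rfl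

/-- Steps can be transferred between equivalent valuations. -/
theorem Tame.exists_step {A : Automaton} {N D : ℕ} (hA : A.Tame N D) {q q' : A.State}
    {v v' w : Valuation A.Clock} (hs : A.Step (q, v) (q', v'))
    (h : RegionEquiv N D (fun x => (v x : ℝ)) fun x => (w x : ℝ)) (G : ℝ → Prop) (hG0 : G 0)
    (hG : ∀ x, ∀ c : ℕ, c ≤ N → (w x : ℝ) ≤ c → G (c - w x)) :
    ∃ δ : NNReal, (δ : ℝ) ≤ N + 1 ∧
      (∃ r r', G r ∧ G r' ∧ ((δ : ℝ) = (r + r') / 2 ∨ (δ : ℝ) = r + 1)) ∧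
      ∃ t ∈ A.trans, t.src = q ∧ t.tgt = q' ∧
        Guard.Sat (fun x => w x + δ) t.guard ∧
        -- Leaving `w'` open allows the result to be supplied later in grid form.
        ∀ w' : Valuation A.Clock, (∀ x, (w' x : ℝ) = (t.update x).eval fun x => w x + δ) →
          RegionEquiv N D (fun x => (v' x : ℝ)) fun x => (w' x : ℝ) := by
  obtain ⟨-, ⟨ε, rfl⟩, t, ht, hsrc, htgt, hg, -, hv'⟩ := hs
  obtain ⟨δ, hδ0, hδN, hδ, hE⟩ := h.exists_delay (fun x => (w x).2) ε ε.2 G hG0 hG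
  lift δ to NNReal using hδ0
  refine ⟨δ, hδN, hδ, t, ht, hsrc, htgt, fun φ hφ => ?_, fun w' hw' => ?_⟩
  · have h1 := (Constraint.sat_iff _ _).1 (hg φ hφ)
    rw [Constraint.sat_iff]
    push_cast at h1 ⊢
    exact (hE.satReal_iff ((hA t ht).1 φ hφ)).1 h1
  · have := hE.update (fun x => (v x + ε).2) (fun x => (w x + δ).2) t.update (hA t ht).2
    simpa only [hv', hw', AtomicUpdate.eval_eq, NNReal.coe_add] using this

/-- The update of a tame transition yields a valuation. -/
theorem _root_.UTA.AtomicUpdate.Tame.eval_nonneg {X : Type} {N D : ℕ} {u : AtomicUpdate X}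
    (hu : u.Tame N D) (v : Valuation X) : 0 ≤ u.eval v := by
  cases u with
  | const c => exact Nat.cast_nonneg c
  | shift y d => exact add_nonneg (v y).2 (by exact_mod_cast hu.1)

/-- `κ` is reached by a run of exactly `i` steps. -/
def ReachIn (A : Automaton) : ℕ → A.Config → Prop
  | 0, κ => κ = (A.init, fun _ => 0)
  | i + 1, κ => ∃ κ₀, A.ReachIn i κ₀ ∧ A.Step κ₀ κ

theorem exists_reachIn {A : Automaton} {κ : A.Config}
    (h : Relation.ReflTransGen A.Step (A.init, fun _ => 0) κ) : ∃ i, A.ReachIn i κ := by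
  induction h with
  | refl => exact ⟨0, rfl⟩
  | tail _ hs ih => exact ih.imp' Nat.succ fun i hi => ⟨_, hi, hs⟩

theorem ReachIn.exists_path {A : Automaton} {k : ℕ} {κ : A.Config} (h : A.ReachIn k κ) :
    ∃ f : ℕ → A.Config, f k = κ ∧ (∀ i ≤ k, A.ReachIn i (f i)) ∧
      ∀ i < k, A.Step (f i) (f (i + 1)) := by
  induction k generalizing κ with
  | zero => exact ⟨fun _ => κ, rfl, fun i hi => by rwa [Nat.le_zero.1 hi], by simp⟩
  | succ k ih =>
    obtain ⟨κ₀, h0, hs⟩ := h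
    obtain ⟨f, hf, hr, hst⟩ := ih h0
    refine ⟨fun i => if i ≤ k then f i else κ, by simp, fun i hi => ?_, fun i hi => ?_⟩
    · dsimp only
      split_ifs with hik
      · exact hr i hik
      · rw [show i = k + 1 by omega]
        exact ⟨κ₀, h0, hs⟩
    · dsimp only
      rcases (Nat.lt_succ_iff.1 hi).lt_or_eq with hik | rfl
      · rw [if_pos hik.le, if_pos (show i + 1 ≤ k from hik)]
        exact hst i hik
      · rw [if_pos le_rfl, if_neg (by omega), hf]
        exact hs

/-- In a longer run two positions share state and signature. The part between them is cut out and
the rest replayed from the earlier configuration; the final valuation may change, the final state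
does not. -/
theorem Tame.exists_short_run {A : Automaton} {N D : ℕ} (hA : A.Tame N D) (hD : D ≤ N) {k : ℕ}
    {κ : A.Config} (h : A.ReachIn k κ) :
    ∃ i ≤ A.numStates * 2 ^ ((A.numClocks + 1) * ((A.numClocks + 1) * (2 * N + 1))),
      ∃ κ' : A.Config, κ'.1 = κ.1 ∧ A.ReachIn i κ' := by
  induction k using Nat.strong_induction_on generalizing κ with
  | _ k ih =>
  rcases le_or_gt k (A.numStates * 2 ^ ((A.numClocks + 1) * ((A.numClocks + 1) * (2 * N + 1))))
    with hk | hk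
  · exact ⟨k, hk, κ, rfl, h⟩
  obtain ⟨f, hf, hr, hst⟩ := h.exists_path
  let F : Fin (k + 1) →
      A.State × (Option A.Clock → Option A.Clock → Fin (2 * N + 1) → Bool) :=
    fun i => ((f i).1, regionSignature N fun x => ((f i).2 x : ℝ))
  have hcard : Fintype.card (A.State × (Option A.Clock → Option A.Clock → Fin (2 * N + 1) → Bool))
      < Fintype.card (Fin (k + 1)) := by
    simp only [Fintype.card_prod, Fintype.card_fin, Fintype.card_pi, Finset.prod_const,
      Finset.card_univ, Fintype.card_option, Fintype.card_bool, ← pow_mul]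
    rw [show (2 * N + 1) * (A.numClocks + 1) * (A.numClocks + 1) =
      (A.numClocks + 1) * ((A.numClocks + 1) * (2 * N + 1)) by ring]
    omega
  have cut : ∀ i j : Fin (k + 1), i < j → F i = F j →
      ∃ κ' : A.Config, κ'.1 = κ.1 ∧ A.ReachIn (i + (k - j)) κ' := by
    intro i j hij hF
    have hjk : (j : ℕ) ≤ k := Nat.lt_succ_iff.1 j.2
    have key : ∀ l, j + l ≤ k → ∃ κ' : A.Config, A.ReachIn (i + l) κ' ∧ (f (j + l)).1 = κ'.1 ∧
        RegionEquiv N D (fun x => ((f (j + l)).2 x : ℝ)) fun x => (κ'.2 x : ℝ) := by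
      intro l
      induction l with
      | zero =>
        intro _
        refine ⟨f i, hr i (Nat.lt_succ_iff.1 i.2), (congrArg Prod.fst hF).symm, ?_⟩
        exact regionEquiv_of_signature_eq hD (fun _ => NNReal.coe_nonneg _)
          (fun _ => NNReal.coe_nonneg _) (congrArg Prod.snd hF).symm
      | succ l ihl =>
        intro hl
        obtain ⟨κ', hκ', hq, hE⟩ := ihl (by omega)
        obtain ⟨δ, -, -, t, ht, hsrc, htgt, hg, hw⟩ :=
          -- The form of the delay is irrelevant here, hence the trivial predicate.
          hA.exists_step (hst (j + l) (by omega)) hE (fun _ => True) trivial fun _ _ _ _ => trivial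
        have hpos : ∀ x, 0 ≤ (t.update x).eval fun x => κ'.2 x + δ :=
          fun x => ((hA t ht).2 x).eval_nonneg _
        refine ⟨(t.tgt, fun x => ⟨_, hpos x⟩), ⟨κ', hκ', (κ'.1, fun x => κ'.2 x + δ), ⟨δ, rfl⟩,
          t, ht, hsrc.trans hq, rfl, hg, hpos, fun x => rfl⟩, htgt.symm, hw _ fun x => rfl⟩
    obtain ⟨κ', hκ', hq, -⟩ := key (k - j) (by omega)
    rw [show (j : ℕ) + (k - j) = k by omega, hf] at hq
    exact ⟨κ', hq.symm, hκ'⟩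
  have hcut : ∃ l < k, ∃ κ' : A.Config, κ'.1 = κ.1 ∧ A.ReachIn l κ' := by
    obtain ⟨i, j, hij, hF⟩ := Fintype.exists_ne_map_eq_of_card_lt F hcard
    rcases lt_or_gt_of_ne hij with hlt | hlt
    · exact ⟨_, by have := Fin.lt_def.1 hlt; omega, cut i j hlt hF⟩
    · exact ⟨_, by have := Fin.lt_def.1 hlt; omega, cut j i hlt hF.symm⟩
  obtain ⟨l, hl, κ', hq, hκ'⟩ := hcut
  obtain ⟨i, hi, κ'', hq', hκ''⟩ := ih l hl hκ'
  exact ⟨i, hi, κ'', hq'.trans hq, hκ''⟩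

end Automaton

/-! ### Correctness of the exploration -/

/-- The valuation with values `g` in units of `1 / s`. -/
noncomputable def gridVal {n : ℕ} (s : ℕ) (g : Fin n → ℕ) : Valuation (Fin n) :=
  fun x => (g x : NNReal) / s

theorem getD_ofFn {n : ℕ} (g : Fin n → ℕ) (x : Fin n) : (List.ofFn g).getD x 0 = g x := by
  simp [List.getD]

theorem gridSat_code_iff {n s : ℕ} (hs : 0 < s) (g : Fin n → ℕ) (φ : Constraint (Fin n)) :
    GridSat s (List.ofFn g) φ.code ↔ φ.Sat (gridVal s g) := by
  have hs' : (0 : ℝ) < s := by exact_mod_cast hs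
  rcases φ with ⟨x, _ | _, c⟩ | ⟨c, _ | _, x⟩ | ⟨x, y, _ | _, d⟩
  · simp [GridSat, gridLhs, gridRhs, Constraint.code, codeInt, Cmp.isStrict, Constraint.Sat,
      Cmp.Holds, gridVal, div_lt_iff₀ hs']
    norm_cast
  · simp [GridSat, gridLhs, gridRhs, Constraint.code, codeInt, Cmp.isStrict, Constraint.Sat,
      Cmp.Holds, gridVal, div_le_iff₀ hs']
    norm_cast
  · simp [GridSat, gridLhs, gridRhs, Constraint.code, codeInt, Cmp.isStrict, Constraint.Sat,
      Cmp.Holds, gridVal, lt_div_iff₀ hs']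
    norm_cast
  · simp [GridSat, gridLhs, gridRhs, Constraint.code, codeInt, Cmp.isStrict, Constraint.Sat,
      Cmp.Holds, gridVal, le_div_iff₀ hs']
    norm_cast
  all_goals
    have hd : (d : ℝ) = (d.toNat : ℝ) - ((-d).toNat : ℝ) := by
      have : d = (d.toNat : ℤ) - ((-d).toNat : ℤ) := by omega
      exact_mod_cast this
    simp only [GridSat, gridLhs, gridRhs, Constraint.code, codeInt, Cmp.isStrict, Constraint.Sat,
      Cmp.Holds, gridVal, NNReal.coe_div, NNReal.coe_natCast, ← sub_div, hd, getD_ofFn,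
      div_lt_iff₀ hs', div_le_iff₀ hs', Bool.toNat_true, Bool.toNat_false, Nat.succ_le_iff,
      if_neg (show (2 : ℕ) ≠ 0 by decide), if_neg (show (2 : ℕ) ≠ 1 by decide), add_zero]
    first | rw [sub_mul, sub_lt_sub_iff] | rw [sub_mul, sub_le_sub_iff]
    rw [add_comm (g y)]
    norm_cast

theorem gridUpdate_code {n s N D : ℕ} (hs : 0 < s) (g : Fin n → ℕ) {u : AtomicUpdate (Fin n)}
    (hu : u.Tame N D) :
    (gridUpdate s (List.ofFn g) u.code : ℝ) / s = u.eval (gridVal s g) := by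
  have hs' : (s : ℝ) ≠ 0 := by exact_mod_cast hs.ne'
  cases u with
  | const c => simp [gridUpdate, AtomicUpdate.code, codeInt, AtomicUpdate.eval, hs']
  | shift y d =>
    have hd : (d : ℝ) = (d.toNat : ℝ) := by
      have : d = (d.toNat : ℤ) := (Int.toNat_of_nonneg hu.1).symm
      exact_mod_cast this
    simp only [gridUpdate, AtomicUpdate.code, codeInt, AtomicUpdate.eval, gridVal, Option.elim,
      getD_ofFn, hd]
    push_cast
    field_simp

theorem mem_gridSucc {s h : ℕ} {T : List TransitionCode} {κ κ' : ℕ × List ℕ} :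
    κ' ∈ gridSucc s h T κ ↔ ∃ t ∈ T, ∃ k < h, GridEnabled s κ t k ∧
      κ' = (t.2.2.2, t.2.2.1.map (gridUpdate s (κ.2.map (· + k)))) := by
  simp only [gridSucc, List.mem_flatMap, List.mem_range]
  refine exists_congr fun t => and_congr_right fun _ => exists_congr fun k =>
    and_congr_right fun _ => ?_
  split_ifs with he <;> simp [he]

theorem mem_gridReach_succ {s h i : ℕ} {T : List TransitionCode} {R : List (ℕ × List ℕ)}
    {κ : ℕ × List ℕ} : κ ∈ gridReach s h T R (i + 1) ↔
      κ ∈ gridReach s h T R i ∨ ∃ κ₀ ∈ gridReach s h T R i, κ ∈ gridSucc s h T κ₀ := by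
  simp only [gridReach, Function.iterate_succ_apply', List.mem_append, List.mem_flatMap]

theorem gridReach_mono {s h i j : ℕ} {T : List TransitionCode} {R : List (ℕ × List ℕ)}
    (hij : i ≤ j) : gridReach s h T R i ⊆ gridReach s h T R j := by
  induction j, hij using Nat.le_induction with
  | base => exact fun _ h => h
  | succ j _ ih => exact fun κ hκ => mem_gridReach_succ.2 (Or.inl (ih hκ))

theorem map_add_ofFn {n : ℕ} (g : Fin n → ℕ) (k : ℕ) :
    (List.ofFn g).map (· + k) = List.ofFn fun x => g x + k := by
  rw [List.map_ofFn]
  rfl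

theorem gridVal_add {n s k : ℕ} (g : Fin n → ℕ) :
    gridVal s (fun x => g x + k) = fun x => gridVal s g x + (k : NNReal) / s := by
  funext x
  simp [gridVal, add_div]

namespace Automaton

theorem gridEnabled_code_iff {A : Automaton} {s : ℕ} (hs : 0 < s) {q : A.State}
    {g : A.Clock → ℕ} {t : Transition A.State A.Clock} {k : ℕ} :
    GridEnabled s (q, List.ofFn g) t.code k ↔
      t.src = q ∧ Guard.Sat (fun x => gridVal s g x + (k : NNReal) / s) t.guard := by
  rw [← gridVal_add]
  simp only [GridEnabled, map_add_ofFn, Transition.code, List.mem_map, forall_exists_index,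
    and_imp, forall_apply_eq_imp_iff₂, gridSat_code_iff hs, Guard.Sat]
  exact and_congr_left' ⟨fun h => (Fin.ext h).symm, fun h => by rw [h]⟩

theorem map_gridUpdate_code {A : Automaton} {s k : ℕ} {g : A.Clock → ℕ}
    (t : Transition A.State A.Clock) :
    t.code.2.2.1.map (gridUpdate s ((List.ofFn g).map (· + k))) =
      List.ofFn fun x => gridUpdate s (List.ofFn fun x => g x + k) (t.update x).code := by
  rw [map_add_ofFn, Transition.code, List.map_ofFn]
  rfl

theorem Tame.gridVal_gridUpdate {A : Automaton} {N D s k : ℕ} (hA : A.Tame N D) (hs : 0 < s)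
    {g : A.Clock → ℕ} {t : Transition A.State A.Clock} (ht : t ∈ A.trans) (x : A.Clock) :
    (gridVal s (fun x => gridUpdate s (List.ofFn fun x => g x + k) (t.update x).code) x : ℝ) =
      (t.update x).eval fun x => gridVal s g x + (k : NNReal) / s := by
  rw [← gridVal_add, ← gridUpdate_code hs _ ((hA t ht).2 x)]
  simp [gridVal]

/-- Soundness of the search: every grid move is a genuine step, for any scale `s > 0` and any bound
`h`. -/
theorem Tame.reachable_of_mem_gridReach {A : Automaton} {N D s h i : ℕ} (hA : A.Tame N D)
    (hs : 0 < s) {κ : ℕ × List ℕ}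
    (hκ : κ ∈ gridReach s h (A.trans.map Transition.code)
      [((A.init : ℕ), List.replicate A.numClocks 0)] i) :
    ∃ (q : A.State) (g : A.Clock → ℕ), κ = ((q : ℕ), List.ofFn g) ∧
      Relation.ReflTransGen A.Step (A.init, fun _ => 0) (q, gridVal s g) := by
  induction i generalizing κ with
  | zero =>
    have hκ : κ = ((A.init : ℕ), List.replicate A.numClocks 0) := by simpa [gridReach] using hκ
    refine ⟨A.init, fun _ => 0, by rw [hκ, List.ofFn_const], ?_⟩
    rw [show gridVal s (fun _ : A.Clock => 0) = fun _ => 0 by funext x; simp [gridVal]]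
  | succ i ih =>
    rcases mem_gridReach_succ.1 hκ with hκ | ⟨κ₀, hκ₀, hκ⟩
    · exact ih hκ
    obtain ⟨q, g, rfl, hr⟩ := ih hκ₀
    obtain ⟨_, htc, k, -, hen, rfl⟩ := mem_gridSucc.1 hκ
    obtain ⟨t, ht, rfl⟩ := List.mem_map.1 htc
    obtain ⟨hsrc, hg⟩ := (gridEnabled_code_iff hs).1 hen
    refine ⟨t.tgt, _, Prod.ext rfl (map_gridUpdate_code t), hr.tail
      ⟨(q, fun x => gridVal s g x + (k : NNReal) / s), ⟨_, rfl⟩, t, ht, hsrc, rfl, hg,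
        fun x => ((hA t ht).2 x).eval_nonneg _, fun x => hA.gridVal_gridUpdate hs ht x⟩⟩

/-- Completeness of the search. The divisibility says that after `i` steps all clocks are multiples
of `2 ^ (-i)`, so the next midpoint still lies on the grid as long as `i < B`. -/
theorem Tame.exists_mem_gridReach {A : Automaton} {N D B i : ℕ} (hA : A.Tame N D) (hi : i ≤ B)
    {κ : A.Config} (h : A.ReachIn i κ) :
    ∃ g : A.Clock → ℕ, ((κ.1 : ℕ), List.ofFn g) ∈ gridReach (2 ^ B) ((N + 1) * 2 ^ B + 1)
        (A.trans.map Transition.code) [((A.init : ℕ), List.replicate A.numClocks 0)] i ∧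
      RegionEquiv N D (fun x => (κ.2 x : ℝ)) (fun x => (gridVal (2 ^ B) g x : ℝ)) ∧
      ∀ x, 2 ^ (B - i) ∣ g x := by
  have hs : 0 < 2 ^ B := by positivity
  have hs' : (0 : ℝ) < ((2 ^ B : ℕ) : ℝ) := by exact_mod_cast hs
  induction i generalizing κ with
  | zero =>
    obtain rfl : κ = _ := h
    refine ⟨fun _ => 0, by simp [gridReach, List.ofFn_const], ?_, fun x => dvd_zero _⟩
    simpa [gridVal] using RegionEquiv.refl _
  | succ i ih =>
    obtain ⟨κ₀, h0, hst⟩ := h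
    obtain ⟨g, hg, hE, hdvd⟩ := ih (by omega) h0
    -- The multiples of `2 ^ (-i)`, written over the common denominator `2 ^ B`.
    let G : ℝ → Prop := fun r => ∃ z : ℤ, r = (z * 2 ^ (B - i) : ℤ) / ((2 ^ B : ℕ) : ℝ)
    have hpow : (2 : ℤ) ^ B = 2 ^ i * 2 ^ (B - i) := by
      rw [← pow_add, Nat.add_sub_cancel' (by omega)]
    obtain ⟨δ, hδN, ⟨r, r', ⟨z, rfl⟩, ⟨z', rfl⟩, hδ⟩, t, ht, hsrc, htgt, hgd, hw⟩ :=
      hA.exists_step hst hE G ⟨0, by simp⟩ (by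
        intro x c _ _
        obtain ⟨m, hm⟩ := hdvd x
        refine ⟨c * 2 ^ i - m, ?_⟩
        have : ((c * 2 ^ i - m) * 2 ^ (B - i) : ℤ) = c * (2 ^ B : ℕ) - g x := by
          rw [hm]
          push_cast
          rw [hpow]
          ring
        rw [this]
        simp only [gridVal, NNReal.coe_div, NNReal.coe_natCast]
        push_cast
        field_simp)
    have hhalf : (2 : ℤ) ^ (B - i) = 2 * 2 ^ (B - (i + 1)) := by
      rw [← pow_succ', show B - (i + 1) + 1 = B - i by omega]
    obtain ⟨y, hy⟩ : ∃ y : ℤ, (δ : ℝ) = (y * 2 ^ (B - (i + 1)) : ℤ) / ((2 ^ B : ℕ) : ℝ) := by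
      rcases hδ with hδ | hδ
      · refine ⟨z + z', ?_⟩
        rw [hδ, hhalf]
        push_cast
        field_simp
      -- In the finer unit `2 ^ (-(i + 1))`, the landmark counts twice and the added `1` is `2 ^ (i
      -- + 1)` units.
      · refine ⟨2 * z + 2 ^ (i + 1), ?_⟩
        have : ((2 * z + 2 ^ (i + 1)) * 2 ^ (B - (i + 1)) : ℤ)
            = z * 2 ^ (B - i) + (2 ^ B : ℕ) := by
          push_cast
          rw [hpow, hhalf]
          ring
        rw [hδ, this]
        push_cast
        field_simp
    have hy0 : 0 ≤ y := by
      by_contra hneg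
      push Not at hneg
      have h1 : (y * 2 ^ (B - (i + 1)) : ℤ) < 0 := mul_neg_of_neg_of_pos hneg (by positivity)
      have h2 : ((y * 2 ^ (B - (i + 1)) : ℤ) : ℝ) < 0 := by exact_mod_cast h1
      have h3 := div_neg_of_neg_of_pos h2 hs'
      have h4 : (0 : ℝ) ≤ δ := δ.2
      linarith
    lift y to ℕ using hy0
    have hδk : δ = ((y * 2 ^ (B - (i + 1)) : ℕ) : NNReal) / (2 ^ B : ℕ) := by
      apply NNReal.coe_injective
      rw [hy]
      push_cast
      rfl
    have hk : y * 2 ^ (B - (i + 1)) < (N + 1) * 2 ^ B + 1 := by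
      rw [hδk] at hδN
      rw [NNReal.coe_div, NNReal.coe_natCast, NNReal.coe_natCast, div_le_iff₀ hs'] at hδN
      exact Nat.lt_succ_iff.2 (by exact_mod_cast hδN)
    rw [hδk] at hgd hw
    refine ⟨_, mem_gridReach_succ.2 (Or.inr ⟨_, hg, mem_gridSucc.2 ⟨t.code,
      List.mem_map_of_mem ht, _, hk, (gridEnabled_code_iff hs).2 ⟨hsrc, hgd⟩, ?_⟩⟩),
      hw _ (fun x => hA.gridVal_gridUpdate hs ht x), fun x => ?_⟩
    · exact Prod.ext (congrArg Fin.val htgt.symm) (map_gridUpdate_code t).symm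
    · have hd1 : 2 ^ (B - (i + 1)) ∣ 2 ^ B := pow_dvd_pow _ (by omega)
      have hd2 : ∀ y, 2 ^ (B - (i + 1)) ∣ g y := fun y =>
        (pow_dvd_pow _ (by omega)).trans (hdvd y)
      rw [gridUpdate]
      refine dvd_add ?_ (hd1.mul_left _)
      cases t.update x with
      | const c => exact dvd_zero _
      | shift y d =>
        simp only [AtomicUpdate.code, Option.elim, getD_ofFn]
        exact dvd_add (hd2 y) (dvd_mul_left _ _)

theorem Tame.exploresFinal_iff {A : Automaton} {D : ℕ} (hA : A.Tame (constBound A.code) D)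
    (hD : D ≤ constBound A.code) : ExploresFinal A.code ↔ A.HasAcceptingRun := by
  constructor
  · rintro ⟨κ, hκ, -, hq', rfl⟩
    obtain ⟨q, g, rfl, hr⟩ := hA.reachable_of_mem_gridReach (by positivity) hκ
    obtain ⟨f, hf, hfq⟩ := List.mem_map.1 hq'
    exact ⟨_, hr, by rwa [← Fin.ext hfq]⟩
  · rintro ⟨κ, hr, hf⟩
    obtain ⟨k, hk⟩ := exists_reachIn hr
    obtain ⟨i, hi, κ', hq, hκ'⟩ := hA.exists_short_run hD hk
    have hi : i ≤ regionBound A.code := hi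
    obtain ⟨g, hg, -⟩ := hA.exists_mem_gridReach hi hκ'
    exact ⟨_, gridReach_mono hi hg, _, List.mem_map_of_mem hf, by rw [hq]⟩

end Automaton

/-! ### Constants and codes -/

/-- Since a code dominates the codes of its components, the number encoding an automaton is itself a
computable bound on all its constants. -/
theorem encode_le_encode_list {α : Type*} [Encodable α] {a : α} {l : List α} (h : a ∈ l) :
    Encodable.encode a ≤ Encodable.encode l := by
  induction l with
  | nil => simp at h
  | cons b l ih =>
    rw [Encodable.encode_list_cons]
    rcases List.mem_cons.1 h with rfl | h
    · exact (Nat.left_le_pair _ _).trans (Nat.le_succ _)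
    · exact (ih h).trans ((Nat.right_le_pair _ _).trans (Nat.le_succ _))

theorem encode_fst_le {α β : Type*} [Encodable α] [Encodable β] (p : α × β) :
    Encodable.encode p.1 ≤ Encodable.encode p :=
  Nat.left_le_pair _ _

theorem encode_snd_le {α β : Type*} [Encodable α] [Encodable β] (p : α × β) :
    Encodable.encode p.2 ≤ Encodable.encode p :=
  Nat.right_le_pair _ _

theorem natAbs_le_encode_codeInt (d : ℤ) : d.natAbs ≤ Encodable.encode (codeInt d) := by
  have h1 : d.toNat ≤ Encodable.encode (codeInt d) := encode_fst_le (codeInt d)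
  have h2 : (-d).toNat ≤ Encodable.encode (codeInt d) := encode_snd_le (codeInt d)
  omega

namespace Automaton

theorem encode_transition_le {A : Automaton} {t : Transition A.State A.Clock} (ht : t ∈ A.trans) :
    Encodable.encode t.code ≤ Encodable.encode A.code :=
  (encode_le_encode_list (List.mem_map_of_mem ht)).trans <| (encode_fst_le A.code.2.2.2).trans <|
    (encode_snd_le A.code.2.2).trans <| (encode_snd_le A.code.2).trans (encode_snd_le A.code)

theorem natAbs_const_le_encode {A : Automaton} {t : Transition A.State A.Clock} (ht : t ∈ A.trans)
    {φ : Constraint A.Clock} (hφ : φ ∈ t.guard) :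
    φ.const.natAbs ≤ Encodable.encode A.code := by
  have h1 : φ.const.natAbs ≤ Encodable.encode φ.code.2.2.2 := by
    cases φ <;> exact natAbs_le_encode_codeInt _
  exact h1.trans <| (encode_snd_le φ.code.2.2).trans <| (encode_snd_le φ.code.2).trans <|
    (encode_snd_le φ.code).trans <| (encode_le_encode_list (List.mem_map_of_mem hφ)).trans <|
    (encode_fst_le t.code.2).trans <| (encode_snd_le t.code).trans (encode_transition_le ht)

theorem natAbs_offset_le_encode {A : Automaton} {t : Transition A.State A.Clock}
    (ht : t ∈ A.trans) (x : A.Clock) :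
    (t.update x).offset.natAbs ≤ Encodable.encode A.code := by
  have h1 : (t.update x).offset.natAbs ≤ Encodable.encode (t.update x).code.2 := by
    cases t.update x <;> exact natAbs_le_encode_codeInt _
  have h2 : (t.update x).code ∈ t.code.2.2.1 := List.mem_ofFn.2 ⟨x, rfl⟩
  exact h1.trans <| (encode_snd_le _).trans <| (encode_le_encode_list h2).trans <|
    (encode_fst_le t.code.2.2).trans <| (encode_snd_le t.code.2).trans <|
    (encode_snd_le t.code).trans (encode_transition_le ht)

/-- Without diagonal guards `D = 0` suffices, and this is what admits positive offsets. -/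
theorem DiagonalFreeIncrementing.tame {A : Automaton} (h : A.DiagonalFreeIncrementing) :
    A.Tame (constBound A.code) 0 := by
  refine fun t ht => ⟨fun φ hφ => ?_, fun x => ?_⟩
  · have h1 := natAbs_const_le_encode ht hφ
    have h2 := (h t ht).1 φ hφ
    cases φ with
    | diag x y s d => exact (h2 trivial).elim
    | _ => simp only [Constraint.Tame, Constraint.const, constBound] at h1 ⊢; omega
  · have h1 := natAbs_offset_le_encode ht x
    have h2 := h.shiftsNonneg t ht x
    cases hx : t.update x with
    | const c => simp only [hx, AtomicUpdate.Tame, AtomicUpdate.offset, constBound] at h1 ⊢; omega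
    | shift y d => exact ⟨h2 y d hx, Or.inl rfl⟩

/-- With `K` the encoding, `D = K + 1` strictly exceeds every constant of a guard, and `constBound`
is `K + D`, just enough for an assigned constant plus `D`. -/
theorem DiagonalCopying.tame {A : Automaton} (h : A.DiagonalCopying) :
    A.Tame (constBound A.code) (Encodable.encode A.code + 1) := by
  refine fun t ht => ⟨fun φ hφ => ?_, fun x => ?_⟩
  · have h1 := natAbs_const_le_encode ht hφ
    cases φ <;> simp only [Constraint.Tame, Constraint.const, constBound, abs_lt] at h1 ⊢ <;> omega
  · have h1 := natAbs_offset_le_encode ht x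
    have h2 := h.shiftsZero t ht x
    cases hx : t.update x with
    | const c => simp only [hx, AtomicUpdate.Tame, AtomicUpdate.offset, constBound] at h1 ⊢; omega
    | shift y d => exact ⟨(h2 y d hx).ge, Or.inr (h2 y d hx)⟩

end Automaton

theorem decidableOn_of_tame {C : Automaton → Prop}
    (h : ∀ A, C A → ∃ D ≤ constBound A.code, A.Tame (constBound A.code) D) :
    DecidableOn C Automaton.HasAcceptingRun := by
  obtain ⟨_, hf⟩ := primrecPred_exploresFinal
  refine ⟨fun c => decide (ExploresFinal c), hf.to_comp, fun A hA => ?_⟩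
  obtain ⟨D, hD, hT⟩ := h A hA
  rw [decide_eq_true_iff, hT.exploresFinal_iff hD]

end UTA

theorem mainTheorem10 :
    UTA.DecidableOn UTA.Automaton.DiagonalFreeIncrementing UTA.Automaton.HasAcceptingRun ∧
    UTA.DecidableOn UTA.Automaton.DiagonalCopying UTA.Automaton.HasAcceptingRun ∧
    ∀ A : UTA.Automaton, A.DiagonalFreeIncrementing ∨ A.DiagonalCopying →
      (∃ k : ℕ, ∀ q : A.State, A.stateGuards (k + 1) q = A.stateGuards k q) ∧
      ∀ (i : ℕ) (q : A.State), ∀ φ ∈ A.stateGuards i q,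
        (φ.IsDiagonal → ∃ t ∈ A.trans, ∃ ψ ∈ t.guard, ψ.const = φ.const) ∧
        (¬ φ.IsDiagonal → φ.const ≤ 2 * (A.maxConstant : ℤ)) := by
  refine ⟨UTA.decidableOn_of_tame fun A hA => ⟨0, Nat.zero_le _, hA.tame⟩,
    UTA.decidableOn_of_tame fun A hA => ⟨_, ?_, hA.tame⟩, fun A hA =>
    ⟨UTA.Automaton.exists_stateGuards_succ_eq hA, fun i q φ hφ => ?_⟩⟩
  · unfold UTA.constBound
    omega
  · have h := UTA.Automaton.bounded_of_mem_stateGuards hA i q φ hφ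
    exact ⟨fun hd => (h.1 hd).2, h.2⟩
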